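/- Let $\Bbbk$ be an algebraically closed field, let $m\ge 0$, and let $\mathbf{Q}$ be the linear quiver $1\to 2\to\cdots\to m$. Let $\mathcal{A}$ be the $\Bbbk$-linear path category of $\mathbf{Q}$: its objects are the vertices, $\mathcal{A}(i,j)$ is the $\Bbbk$-span of the paths from $i$ to $j$, and composition is concatenation. Let $\mathcal{A}\text{-mod}$ be the category of finite dimensional left $\mathcal{A}$-modules, that is, of covariant $\Bbbk$-linear functors from $\mathcal{A}$ to finite dimensional vector spaces (equivalently, of finite dimensional representations of $\mathbf{Q}$). For a vertex $i$ let $L_i$ be the simple module that is $\Bbbk$ at $i$ and zero at the other vertices, and let $\mathrm{F}_i=\mathrm{Id}/\mathrm{Tr}_{L_i}$ be the endofunctor of $\mathcal{A}\text{-mod}$ that sends $N$ to its quotient by the sum of the images of all homomorphisms $L_i\to N$. Let $I=\mathcal{A}(-,-)^*$ be the $\Bbbk$-dual of the regular $\mathcal{A}$-$\mathcal{A}$-bimodule, and put $$\mathrm{G}_i:=\mathrm{Hom}_{\mathcal{A}}((\mathrm{F}_i I)^*,-):\mathcal{A}\text{-mod}\to\mathcal{A}\text{-mod},$$ where $\mathrm{F}_i$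 is applied to the left module structure of $I$, and $\mathrm{Hom}_{\mathcal{A}}$ denotes homomorphisms of left modules, with the left action induced by the right action on $(\mathrm{F}_i I)^*$. Then for every finite sequence $(i_1,\dots,i_r)$ of vertices of $\mathbf{Q}$ the composition $\mathrm{G}_{i_1}\circ\mathrm{G}_{i_2}\circ\cdots\circ\mathrm{G}_{i_r}$ (the identity functor if $r=0$) is either zero or an indecomposable functor. Here a functor is called indecomposable if it is nonzero and, whenever it is isomorphic to a direct sum $Y\oplus Z$ of endofunctors of $\mathcal{A}\text{-mod}$, one has $Y=0$ or $Z=0$. -/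

import Mathlib

open CategoryTheory CategoryTheory.Limits

universe u

noncomputable section

namespace QuiverCat

lemma hom_hom_ofHom {k : Type u} [Field k] {V W : Type u} [AddCommGroup V] [Module k V]
    [Module.Finite k V] [AddCommGroup W] [Module k W] [Module.Finite k W] (f : V →ₗ[k] W) :
    (FGModuleCat.ofHom f).hom.hom = f := rfl

section General

variable (k : Type u) [Field k] (Γ : Type) [Quiver.{0} Γ]

/-- Finite dimensional left modules over the `k`-linear path category of `Γ`, in the form of finite
dimensional representations of `Γ`: covariant functors from the category of paths in `Γ` to finite
dimensional vector spaces. Morphisms are natural transformations. -/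
abbrev Rep : Type (u + 1) := Paths Γ ⥤ FGModuleCat.{u} k

/-- Bimodules over the path category: the contravariant variable carries the right module structure
and the covariant variable the left module structure. -/
abbrev Bimod : Type (u + 1) := (Paths Γ)ᵒᵖ ⥤ Rep k Γ

variable {Γ}

/-- The simple module `L_i`: it is `k` at the vertex `i` and zero at the other vertices, and every
arrow acts by zero. -/
def simpleRep (i : Γ) : Rep k Γ :=
  Paths.lift
    { obj := fun j => FGModuleCat.of k (PLift (j = i) → k)
      map := fun _ => 0 }

variable {k}

/-- The value at the vertex `j` of the trace of `M` in `N`, the sum of the images of all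
homomorphisms from `M` to `N`. -/
def trace (M N : Rep k Γ) (j : Paths Γ) : Submodule k (N.obj j) :=
  ⨆ φ : M ⟶ N, LinearMap.range (φ.app j).hom.hom

/-- The trace is a submodule of `N` (stable under all paths). -/
lemma trace_le_comap (M N : Rep k Γ) {j j' : Paths Γ} (f : j ⟶ j') :
    trace M N j ≤ (trace M N j').comap (N.map f).hom.hom := by
  refine iSup_le fun φ => ?_
  rintro _ ⟨x, rfl⟩
  refine Submodule.mem_iSup_of_mem φ ⟨(M.map f).hom.hom x, ?_⟩
  exact congrArg (fun g => g.hom.hom x) (φ.naturality f)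

/-- The trace is functorial in the second argument. -/
lemma trace_le_comap_app (M : Rep k Γ) {N N' : Rep k Γ} (ψ : N ⟶ N') (j : Paths Γ) :
    trace M N j ≤ (trace M N' j).comap (ψ.app j).hom.hom := by
  refine iSup_le fun φ => ?_
  rintro _ ⟨x, rfl⟩
  exact Submodule.mem_iSup_of_mem (φ ≫ ψ) ⟨x, rfl⟩

/-- The quotient `N / Tr_M(N)`. -/
def modTraceObj (M N : Rep k Γ) : Rep k Γ where
  obj j := FGModuleCat.of k (N.obj j ⧸ trace M N j)
  map {j j'} f := FGModuleCat.ofHom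
    (Submodule.mapQ (trace M N j) (trace M N j') (N.map f).hom.hom (trace_le_comap M N f))
  map_id j := by
    ext x
    simp [hom_hom_ofHom]
  map_comp f g := by
    ext x
    simp [hom_hom_ofHom]

/-- The functor `Id / Tr_M`. -/
def modTrace (M : Rep k Γ) : Rep k Γ ⥤ Rep k Γ where
  obj N := modTraceObj M N
  map {N N'} ψ :=
    { app := fun j => FGModuleCat.ofHom
        (Submodule.mapQ (trace M N j) (trace M N' j) (ψ.app j).hom.hom
          (trace_le_comap_app M ψ j))
      naturality := fun j j' f => by
        ext x
        obtain ⟨x, rfl⟩ := Submodule.Quotient.mk_surjective _ x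
        exact congrArg (Submodule.Quotient.mk (p := trace M N' j'))
          (congrArg (fun g => g.hom.hom x) (ψ.naturality f)) }
  map_id N := by
    ext j x
    simp
    rfl
  map_comp φ ψ := by
    ext j x
    obtain ⟨x, rfl⟩ := Submodule.Quotient.mk_surjective _ x
    rfl

variable (k)

/-- The projection functor `F_i = Id / Tr_{L_i}`. -/
def projFunctor (i : Γ) : Rep k Γ ⥤ Rep k Γ := modTrace (simpleRep k i)

variable (Γ)

/-- The regular bimodule `P`, whose value at `(i, j)` is the vector space with basis the paths from
`i` to `j`. -/
def regularBimod [∀ i j : Paths Γ, Finite (i ⟶ j)] : Bimod k Γ where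
  obj i :=
    { obj := fun j => FGModuleCat.of k ((i.unop ⟶ j) →₀ k)
      map := fun f => FGModuleCat.ofHom (Finsupp.lmapDomain k k (fun p => p ≫ f))
      map_id := fun j => by
        ext x
        simp [hom_hom_ofHom]
      map_comp := fun f g => by
        ext x
        simp [hom_hom_ofHom] }
  map g :=
    { app := fun j => FGModuleCat.ofHom (Finsupp.lmapDomain k k (fun p => g.unop ≫ p))
      naturality := fun j j' f => by
        ext x
        simp [hom_hom_ofHom] }
  map_id i := by
    ext j x
    simp [hom_hom_ofHom]
  map_comp g h := by
    ext j x
    simp [hom_hom_ofHom]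

variable {k Γ}

/-- The `k`-dual bimodule `B^*`, with `B^*(y, x) = B(x, y)^*`. -/
def dualBimod (B : Bimod k Γ) : Bimod k Γ where
  obj y :=
    { obj := fun x => FGModuleCat.of k (Module.Dual k ((B.obj (Opposite.op x)).obj y.unop))
      map := fun f => FGModuleCat.ofHom (((B.map f.op).app y.unop).hom.hom.dualMap)
      map_id := fun x => by
        ext φ
        simp [hom_hom_ofHom]
      map_comp := fun f g => by
        ext φ
        simp [hom_hom_ofHom] }
  map g :=
    { app := fun x => FGModuleCat.ofHom (((B.obj (Opposite.op x)).map g.unop).hom.hom.dualMap)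
      naturality := fun x x' f => by
        refine FGModuleCat.hom_ext (LinearMap.ext fun φ => LinearMap.ext fun b => ?_)
        exact congrArg (fun c => (show Module.Dual k _ from φ) c)
          (congrArg (fun h => h.hom.hom b) ((B.map f.op).naturality g.unop)) }
  map_id y := by
    ext x φ
    simp [hom_hom_ofHom]
  map_comp g h := by
    ext x φ
    simp [hom_hom_ofHom]

variable (k Γ)

/-- The bimodule `I = P^*`, the injective cogenerator. -/
def injBimod [∀ i j : Paths Γ, Finite (i ⟶ j)] : Bimod k Γ := dualBimod (regularBimod k Γ)

variable {k Γ}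

/-- The space of homomorphisms between two finite dimensional modules is finite dimensional, as the
quiver has finitely many vertices. -/
instance finite_hom [Finite Γ] (M N : Rep k Γ) : Module.Finite k (M ⟶ N) := by
  have : Finite (Paths Γ) := inferInstanceAs (Finite Γ)
  refine Module.Finite.of_injective
    (LinearMap.pi (fun j : Paths Γ => NatTrans.appLinearMap (R := k) (F := M) (G := N) j)) ?_
  intro φ ψ h
  ext1
  funext j
  exact congrFun h j

/-- The functor `Hom(B, -)` of homomorphisms of left modules, for a bimodule `B`: the left module
structure on `Hom(B, M)` comes from the right module structure on `B`. -/
def homFunctor [Finite Γ] (B : Bimod k Γ) : Rep k Γ ⥤ Rep k Γ where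
  obj M :=
    { obj := fun y => FGModuleCat.of k (B.obj (Opposite.op y) ⟶ M)
      map := fun f => FGModuleCat.ofHom (Linear.leftComp k M (B.map f.op))
      map_id := fun y => by
        ext φ
        simp [hom_hom_ofHom]
      map_comp := fun f g => by
        ext φ
        simp [hom_hom_ofHom] }
  map ψ :=
    { app := fun y => FGModuleCat.ofHom (Linear.rightComp k (B.obj (Opposite.op y)) ψ)
      naturality := fun y y' f => by
        ext φ
        simp [hom_hom_ofHom] }
  map_id M := by
    ext y φ
    simp [hom_hom_ofHom]
  map_comp φ ψ := by
    ext y χ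
    simp [hom_hom_ofHom]

variable (k)

/-- The functor `G_i = Hom((F_i I)^*, -)`, where `F_i` is applied to the left module structure
of `I`. -/
def G [Finite Γ] [∀ i j : Paths Γ, Finite (i ⟶ j)] (i : Γ) : Rep k Γ ⥤ Rep k Γ :=
  homFunctor (dualBimod (injBimod k Γ ⋙ projFunctor k i))

/-- The composition `G_{i_1} ∘ G_{i_2} ∘ ⋯ ∘ G_{i_r}` for a list `[i_1, i_2, …, i_r]`
(the functor `G_{i_r}` is applied first; the empty composition is the identity). -/
def compG [Finite Γ] [∀ i j : Paths Γ, Finite (i ⟶ j)] : List Γ → (Rep k Γ ⥤ Rep k Γ)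
  | [] => 𝟭 (Rep k Γ)
  | i :: l => compG l ⋙ G k i

end General

/-- The vertices of the linear quiver `1 ⟶ 2 ⟶ ⋯ ⟶ m`, numbered from `0`. -/
def LinearQuiver (m : ℕ) : Type := Fin m

/-- There is exactly one arrow from each vertex to the next one, and no others. -/
instance (m : ℕ) : Quiver.{0} (LinearQuiver m) where
  Hom i j := PLift (Fin.val i + 1 = Fin.val j)

instance (m : ℕ) : Finite (LinearQuiver m) := inferInstanceAs (Finite (Fin m))

/-- Paths in the linear quiver do not decrease the vertex. -/
lemma LinearQuiver.path_val_le {m : ℕ} {i j : LinearQuiver m} (p : Quiver.Path i j) :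
    Fin.val i ≤ Fin.val j := by
  induction p with
  | nil => exact le_rfl
  | cons _ f ih => have := f.down; omega

/-- There is at most one path between two vertices of the linear quiver. -/
instance (m : ℕ) (i j : Paths (LinearQuiver m)) : Subsingleton (i ⟶ j) := by
  constructor
  intro p q
  change Quiver.Path (V := LinearQuiver m) i j at p q
  induction p with
  | nil =>
    cases q with
    | nil => rfl
    | cons q f =>
      exfalso
      have h1 := LinearQuiver.path_val_le q
      have h2 := f.down
      omega
  | cons p f ih =>
    cases q with
    | nil =>
      exfalso
      have h1 := LinearQuiver.path_val_le p
      have h2 := f.down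
      omega
    | cons q g =>
      have h : Fin.val _ + 1 = Fin.val _ := f.down
      have h' : Fin.val _ + 1 = Fin.val _ := g.down
      obtain rfl := Fin.ext (Nat.succ_injective (h.trans h'.symm))
      have e : f = g := Subsingleton.elim (α := PLift (Fin.val _ + 1 = Fin.val _)) f g
      rw [ih q, e]

end QuiverCat

end

/-! The double dual of the regular bimodule is the regular bimodule, so `(F_i I)^*` is the regular
bimodule with its component at `(i, i)` removed: in `I`, that component is exactly what the trace of
`L_i` kills. As a left module it is the projective at `y` for each `y ≠ i`, while at `y = i` it is
the radical of the projective at `i`, hence the projective at the next vertex, or zero if `i` is the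
last one. Thus each component of `G k i` is zero or evaluation at a vertex, and paths act through
evaluation along paths (`isLocallyEval_G`). This property, `IsLocallyEval`, survives composition. By
Yoneda an endomorphism of an evaluation functor is a scalar. Evaluation along a path is nonzero, so
naturality forces the scalars at all nonvanishing components to agree with the one at the source
vertex (`IsLocallyEval.exists_scalar`). An object with only scalar endomorphisms has no nontrivial
decomposition. -/

noncomputable section

namespace QuiverCat

section Functors

variable {k : Type u} [Field k]

/-! ### Functors that are locally evaluations. -/

section Evaluation

variable {Γ : Type} [Quiver.{0} Γ]

variable (k Γ) in
/-- Evaluation of representations at vertices, as a functor of the vertex. -/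
abbrev evalAt : Paths Γ ⥤ Rep k Γ ⥤ FGModuleCat.{u} k := evaluation (Paths Γ) (FGModuleCat.{u} k)

/-- A functor is locally an evaluation if every path acts on its values, up to isomorphism,
like a path acts on the representations themselves, unless the values at the end vanish. -/
def IsLocallyEval (H : Rep k Γ ⥤ Rep k Γ) : Prop :=
  ∀ ⦃y y' : Paths Γ⦄ (p : y ⟶ y'), IsZero (H ⋙ (evalAt k Γ).obj y') ∨
    ∃ (x x' : Paths Γ) (q : x ⟶ x'),
      Nonempty (Arrow.mk (Functor.whiskerLeft H ((evalAt k Γ).map p)) ≅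
        Arrow.mk ((evalAt k Γ).map q))

lemma isLocallyEval_id : IsLocallyEval (𝟭 (Rep k Γ)) :=
  fun y y' p => Or.inr ⟨y, y', p, ⟨Arrow.isoMk (Functor.leftUnitor _) (Functor.leftUnitor _)⟩⟩

lemma IsLocallyEval.comp {H K : Rep k Γ ⥤ Rep k Γ} (hH : IsLocallyEval H)
    (hK : IsLocallyEval K) : IsLocallyEval (H ⋙ K) := by
  intro y y' p
  have key : ∀ {A A' : Rep k Γ ⥤ FGModuleCat.{u} k}, IsZero A' → IsZero (H ⋙ A') := by
    intro _ A' h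
    rw [Functor.isZero_iff] at h ⊢
    exact fun M => h _
  rcases hK p with h | ⟨x, x', q, ⟨e⟩⟩
  · exact Or.inl (key (A := K ⋙ (evalAt k Γ).obj y') h)
  -- Precomposition with `H` turns evaluation along `q` into the action of `q` on the values of `H`.
  · let e' := ((Functor.whiskeringLeft _ _ (FGModuleCat.{u} k)).obj H).mapArrow.mapIso e
    rcases hH q with h | ⟨z, z', r, ⟨f⟩⟩
    · exact Or.inl (h.of_iso (Comma.rightIso e'))
    · exact Or.inr ⟨z, z', r, ⟨e' ≪≫ f⟩⟩

end Evaluation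

/-! ### Endomorphisms of evaluation functors. -/

section Yoneda

variable {Γ : Type} [Quiver.{0} Γ] [∀ i j : Paths Γ, Finite (i ⟶ j)]

variable (k) in
/-- The indecomposable projective representation at `x`. -/
abbrev projRep (x : Paths Γ) : Rep k Γ := (regularBimod k Γ).obj (Opposite.op x)

/-- The morphism from the projective at `x` given by an element at `x`. -/
def projRepDesc {x : Paths Γ} (M : Rep k Γ) (v : M.obj x) : projRep k x ⟶ M where
  app z := FGModuleCat.ofHom
    (Finsupp.linearCombination k (fun f : x ⟶ z => (M.map f).hom.hom v))
  naturality z z' f := by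
    refine FGModuleCat.hom_ext (Finsupp.lhom_ext' fun p => LinearMap.ext_ring ?_)
    change Finsupp.linearCombination k (fun f : x ⟶ z' => (M.map f).hom.hom v)
        (Finsupp.mapDomain (fun p => p ≫ f) (Finsupp.single p 1)) =
      (M.map f).hom.hom (Finsupp.linearCombination k (fun f : x ⟶ z => (M.map f).hom.hom v)
        (Finsupp.single p 1))
    simp

variable (k) in
/-- The canonical generator of the projective at `x`. -/
def projRepGen (x : Paths Γ) : (projRep k x).obj x :=
  (Finsupp.single (𝟙 x) 1 : (x ⟶ x) →₀ k)

lemma projRepDesc_gen {x : Paths Γ} (M : Rep k Γ) (v : M.obj x) :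
    ((projRepDesc M v).app x).hom.hom (projRepGen k x) = v := by
  change Finsupp.linearCombination k (fun f : x ⟶ x => (M.map f).hom.hom v)
        (Finsupp.single (𝟙 x) 1) = v
  simp

lemma evalAt_map_ne_zero {x x' : Paths Γ} (q : x ⟶ x') : (evalAt k Γ).map q ≠ 0 := by
  intro h
  have h1 := congrArg (fun t => (t.app (projRep k x)).hom.hom (projRepGen k x)) h
  have h2 : (Finsupp.mapDomain (fun p => p ≫ q) (Finsupp.single (𝟙 x) 1) : (x ⟶ x') →₀ k) = 0 := h1
  simp at h2

/-- Yoneda: `η` is determined by the image of the generator of the projective at `x`, whose value at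
`x` is one-dimensional because the only loop is the identity. -/
lemma exists_scalar_of_evalAt_end [∀ i : Paths Γ, Subsingleton (i ⟶ i)] {x : Paths Γ}
    (η : (evalAt k Γ).obj x ⟶ (evalAt k Γ).obj x) : ∃ c : k, η = c • 𝟙 _ := by
  obtain ⟨c, hc⟩ : ∃ c : k, (η.app (projRep k x)).hom.hom (projRepGen k x) =
      c • projRepGen k x := by
    let w : (x ⟶ x) →₀ k := (η.app (projRep k x)).hom.hom (projRepGen k x)
    refine ⟨w (𝟙 x), ?_⟩
    change w = w (𝟙 x) • (Finsupp.single (𝟙 x) 1 : (x ⟶ x) →₀ k)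
    ext f
    obtain rfl := Subsingleton.elim f (𝟙 x)
    simp
  refine ⟨c, ?_⟩
  ext M v
  have h1 := congrArg (fun t => t.hom.hom (projRepGen k x)) (η.naturality (projRepDesc M v))
  have h2 : (η.app M).hom.hom (((projRepDesc M v).app x).hom.hom (projRepGen k x)) =
    ((projRepDesc M v).app x).hom.hom ((η.app (projRep k x)).hom.hom (projRepGen k x)) := h1
  rw [hc, map_smul, projRepDesc_gen] at h2
  exact h2

end Yoneda

/-! ### Scalar endomorphisms and indecomposability. -/

section Indecomposable

variable {Γ : Type} [Quiver.{0} Γ] [∀ i j : Paths Γ, Finite (i ⟶ j)]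

lemma IsLocallyEval.exists_scalar [∀ i : Paths Γ, Subsingleton (i ⟶ i)]
    {H : Rep k Γ ⥤ Rep k Γ} (hH : IsLocallyEval H)
    (z : Paths Γ) (hz : ∀ y : Paths Γ, Nonempty (z ⟶ y)) (e : H ⟶ H) :
    ∃ c : k, e = c • 𝟙 H := by
  have conj : ∀ (A : Rep k Γ ⥤ FGModuleCat.{u} k) (x : Paths Γ) (_ : A ≅ (evalAt k Γ).obj x)
      (η : A ⟶ A), ∃ c : k, η = c • 𝟙 A := by
    intro A x α η
    obtain ⟨c, hc⟩ := exists_scalar_of_evalAt_end (α.inv ≫ η ≫ α.hom)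
    refine ⟨c, ?_⟩
    have := congrArg (fun t => α.hom ≫ t ≫ α.inv) hc
    simpa using this
  obtain ⟨c, hc⟩ : ∃ c : k, Functor.whiskerRight e ((evalAt k Γ).obj z) = c • 𝟙 _ := by
    rcases hH (𝟙 z) with h | ⟨x, x', q, ⟨a⟩⟩
    -- The component at `z` vanishes, so any scalar would do.
    · exact ⟨0, h.eq_of_src _ _⟩
    · exact conj _ _ (Comma.rightIso a) _
  have hy : ∀ y, Functor.whiskerRight e ((evalAt k Γ).obj y) = c • 𝟙 _ := by
    intro y
    obtain ⟨p⟩ := hz y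
    rcases hH p with h | ⟨x, x', q, ⟨a⟩⟩
    · exact h.eq_of_src _ _
    · obtain ⟨c', hc'⟩ := conj _ _ (Comma.rightIso a) (Functor.whiskerRight e ((evalAt k Γ).obj y))
      set T := Functor.whiskerLeft H ((evalAt k Γ).map p) with hT
      have hT0 : T ≠ 0 := by
        intro h0
        refine evalAt_map_ne_zero (k := k) q ?_
        have h3 : (evalAt k Γ).map q = a.inv.left ≫ T ≫ a.hom.right := by
          have h4 := Arrow.w a.inv
          simp only [Arrow.mk_hom] at h4
          rw [← Category.assoc, h4, Category.assoc, ← Arrow.comp_right]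
          simp
        rw [h3]
        exact (congrArg (fun t => a.inv.left ≫ t ≫ a.hom.right) h0).trans (by simp)
      have hn : Functor.whiskerRight e ((evalAt k Γ).obj z) ≫ T =
          T ≫ Functor.whiskerRight e ((evalAt k Γ).obj y) := by
        ext1
        funext M
        exact ((e.app M).naturality p).symm
      rw [hc, hc'] at hn
      have h5 : (c - c') • T = 0 := by
        rw [sub_smul, sub_eq_zero]
        simpa using hn
      rcases smul_eq_zero.1 h5 with h6 | h6
      · rw [hc', sub_eq_zero.1 h6]
        rfl
      · exact absurd h6 hT0
  refine ⟨c, ?_⟩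
  ext M : 2
  ext1
  funext y
  exact congrArg (fun t => t.app M) (hy y)

/-- The idempotent projecting onto `Y` is a scalar `c`; compressing it to `Y` gives the identity, to
`Z` gives zero. -/
lemma isZero_or_isZero_of_end_scalar {C : Type*} [Category C] [Preadditive C] [Linear k C]
    [HasBinaryBiproducts C] {X Y Z : C} (hX : ∀ e : X ⟶ X, ∃ c : k, e = c • 𝟙 X)
    (i : X ≅ Y ⊞ Z) : IsZero Y ∨ IsZero Z := by
  obtain ⟨c, hc⟩ := hX (i.hom ≫ biprod.fst ≫ biprod.inl ≫ i.inv)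
  have h : (biprod.fst ≫ biprod.inl : Y ⊞ Z ⟶ Y ⊞ Z) = c • 𝟙 _ := by
    have := congrArg (fun t => i.inv ≫ t ≫ i.hom) hc
    simpa using this
  have hY : 𝟙 Y = c • 𝟙 Y := by
    have := congrArg (fun t => biprod.inl ≫ t ≫ biprod.fst) h
    simpa using this
  have hZ : c • 𝟙 Z = 0 := by
    have := congrArg (fun t => biprod.inr ≫ t ≫ biprod.snd) h
    simpa using this.symm
  rcases smul_eq_zero.1 hZ with h0 | h0
  · left
    rw [IsZero.iff_id_eq_zero, hY, h0, zero_smul]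
  · right
    rw [IsZero.iff_id_eq_zero, h0]

end Indecomposable

end Functors

end QuiverCat

end

noncomputable section

namespace QuiverCat

/-! ### Hom functors of thin bimodules. -/

section Bimodules

variable {k : Type u} [Field k] {Γ : Type} [Quiver.{0} Γ]

/-- Evaluation of homomorphisms at an element. -/
def homEval {V : Rep k Γ} {s : Paths Γ} (g : V.obj s) (M : Rep k Γ) : (V ⟶ M) →ₗ[k] M.obj s where
  toFun φ := (φ.app s).hom.hom g
  map_add' _ _ := rfl
  map_smul' _ _ := rfl

/-- The hypotheses make `V` free on `g`: `ε` is a coordinate on spaces of dimension at most one,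
constant along paths, so `V` is a copy of the projective at `s`. -/
lemma homEval_bijective [∀ i j : Paths Γ, Subsingleton (i ⟶ j)] {V : Rep k Γ} {s : Paths Γ}
    (g : V.obj s) (ε : ∀ x, V.obj x →ₗ[k] k) (hε : ∀ x, Function.Injective (ε x))
    (hnat : ∀ {x x' : Paths Γ} (f : x ⟶ x') (v : V.obj x), ε x' ((V.map f).hom.hom v) = ε x v)
    (hg : ε s g = 1) (hV : ∀ x, Nonempty (s ⟶ x) ∨ Subsingleton (V.obj x)) (M : Rep k Γ) :
    Function.Bijective (homEval g M) := by
  constructor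
  · intro φ ψ h
    ext x v
    rcases hV x with ⟨⟨f⟩⟩ | h0
    · have hv : v = ε x v • (V.map f).hom.hom g := by
        apply hε x
        rw [map_smul, hnat, hg, smul_eq_mul, mul_one]
      have nat : ∀ χ : V ⟶ M, (χ.app x).hom.hom ((V.map f).hom.hom g) =
          (M.map f).hom.hom (homEval g M χ) :=
        fun χ => congrArg (fun t => t.hom.hom g) (χ.naturality f)
      change (φ.app x).hom.hom v = (ψ.app x).hom.hom v
      rw [hv, map_smul, map_smul, nat, nat, h]
    · obtain rfl : v = 0 := Subsingleton.elim _ _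
      rw [map_zero, map_zero]
  · intro w
    classical
    -- The default value is harmless: `V` vanishes at vertices not reachable from `s`.
    let m : ∀ x, M.obj x := fun x =>
      if h : Nonempty (s ⟶ x) then (M.map h.some).hom.hom w else 0
    have hm : ∀ {x} (f : s ⟶ x), m x = (M.map f).hom.hom w := by
      intro x f
      have h : Nonempty (s ⟶ x) := ⟨f⟩
      simp only [m, dif_pos h, Subsingleton.elim h.some f]
    refine ⟨{ app := fun x => FGModuleCat.ofHom ((ε x).smulRight (m x)),
              naturality := ?_ }, ?_⟩
    · intro x x' f
      refine FGModuleCat.hom_ext (LinearMap.ext fun v => ?_)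
      change ε x' ((V.map f).hom.hom v) • m x' = (M.map f).hom.hom (ε x v • m x)
      rw [hnat, map_smul]
      rcases hV x with ⟨⟨r⟩⟩ | h0
      · rw [hm r, hm (r ≫ f), M.map_comp]
        rfl
      · obtain rfl : v = 0 := Subsingleton.elim _ _
        rw [map_zero, zero_smul, zero_smul]
    · change ε s g • m s = w
      rw [hg, one_smul, hm (𝟙 s), M.map_id]
      rfl

/-- If evaluation at `g` is bijective, the value of `Hom(B, -)` at `y` is evaluation at a vertex. -/
def homFunctorIso [Finite Γ] {B : Bimod k Γ} {y s : Paths Γ} (g : (B.obj (Opposite.op y)).obj s)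
    (hg : ∀ M, Function.Bijective (homEval g M)) :
    homFunctor B ⋙ (evalAt k Γ).obj y ≅ (evalAt k Γ).obj s :=
  NatIso.ofComponents
    (fun M => (LinearEquiv.ofBijective (homEval g M) (hg M)).toFGModuleCatIso)
    (fun _ => rfl)

/-- A bimodule over a thin path category whose left modules are zero or cyclic and free, with
coefficient maps `ε` compatible with both structures, defines a local evaluation functor. -/
lemma isLocallyEval_homFunctor [Finite Γ] [∀ i j : Paths Γ, Subsingleton (i ⟶ j)] (B : Bimod k Γ)
    (ε : ∀ y x : Paths Γ, (B.obj (Opposite.op y)).obj x →ₗ[k] k)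
    (hε : ∀ y x, Function.Injective (ε y x))
    (hleft : ∀ (y : Paths Γ) {x x' : Paths Γ} (f : x ⟶ x') (v : (B.obj (Opposite.op y)).obj x),
      ε y x' (((B.obj (Opposite.op y)).map f).hom.hom v) = ε y x v)
    (hright : ∀ {y y' : Paths Γ} (p : y ⟶ y') (x : Paths Γ)
      (v : (B.obj (Opposite.op y')).obj x), ε y x (((B.map p.op).app x).hom.hom v) = ε y' x v)
    (hB : ∀ y, (∀ x, Subsingleton ((B.obj (Opposite.op y)).obj x)) ∨
      ∃ (s : Paths Γ) (g : (B.obj (Opposite.op y)).obj s), ε y s g = 1 ∧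
        ∀ x, Nonempty (s ⟶ x) ∨ Subsingleton ((B.obj (Opposite.op y)).obj x)) :
    IsLocallyEval (homFunctor B) := by
  intro y y' p
  rcases hB y' with h0 | ⟨s', g', hg', hV'⟩
  · left
    rw [Functor.isZero_iff]
    intro M
    rw [IsZero.iff_id_eq_zero]
    refine FGModuleCat.hom_ext (LinearMap.ext fun (φ : B.obj (Opposite.op y') ⟶ M) => ?_)
    change φ = 0
    ext x v
    have := h0 x
    obtain rfl : v = 0 := Subsingleton.elim _ _
    change (φ.app x).hom.hom 0 = 0
    rw [map_zero]
  -- The right action preserves coefficients, so the module at `y` is nonzero whenever the one at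
  -- `y'` is. Its generator then reaches `s'`, which yields the path `q`.
  · have hgy : ε y s' (((B.map p.op).app s').hom.hom g') = 1 := by rw [hright, hg']
    have hns : ¬ Subsingleton ((B.obj (Opposite.op y)).obj s') := by
      intro h
      rw [Subsingleton.elim (((B.map p.op).app s').hom.hom g') 0, map_zero] at hgy
      exact zero_ne_one hgy
    rcases hB y with h0 | ⟨s, g, hg, hV⟩
    · exact absurd (h0 s') hns
    · obtain ⟨q⟩ := (hV s').resolve_right hns
      have hq : ((B.map p.op).app s').hom.hom g' =
          ((B.obj (Opposite.op y)).map q).hom.hom g := by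
        apply hε y s'
        rw [hgy, hleft, hg]
      refine Or.inr ⟨s, s', q, ⟨Arrow.isoMk
        (homFunctorIso g (homEval_bijective g (ε y) (hε y) (hleft y) hg hV))
        (homFunctorIso g' (homEval_bijective g' (ε y') (hε y') (hleft y') hg' hV')) ?_⟩⟩
      ext M φ
      change (M.map q).hom.hom ((φ.app s).hom.hom g) =
        (φ.app s').hom.hom (((B.map p.op).app s').hom.hom g')
      rw [hq]
      exact (congrArg (fun t => t.hom.hom g) (φ.naturality q)).symm

lemma simpleRep_eq_zero {i : Γ} {j : Paths Γ} (h : j ≠ i) (v : (simpleRep k i).obj j) :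
    v = 0 := by
  funext (e : PLift (j = i))
  exact absurd e.down h

lemma map_comp_eq_comp_map {C D : Type*} [Category C] [Category D] (F F' : C ⥤ D) {j : C}
    [Subsingleton (j ⟶ j)] (f : j ⟶ j) (α : F.obj j ⟶ F'.obj j) :
    F.map f ≫ α = α ≫ F'.map f := by
  simp [Subsingleton.elim f (𝟙 j)]

/-! ### The bimodule `(F_i I)^*`. -/

variable [∀ i j : Paths Γ, Finite (i ⟶ j)]

/-- The functional taking the sum of the coefficients at all paths from `y` to `x`. -/
def sumCoeff (y x : Paths Γ) : ((injBimod k Γ).obj (Opposite.op x)).obj y :=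
  (Finsupp.linearCombination k (fun _ => 1) : Module.Dual k ((y ⟶ x) →₀ k))

lemma sumCoeff_single (y x : Paths Γ) (r : y ⟶ x) :
    (show Module.Dual k ((y ⟶ x) →₀ k) from sumCoeff y x) (Finsupp.single r 1) = 1 := by
  change Finsupp.linearCombination k (fun _ => (1 : k)) (Finsupp.single r 1) = 1
  simp

lemma injBimod_map_left {y y' : Paths Γ} (p : y ⟶ y') (x : Paths Γ) :
    (((injBimod k Γ).obj (Opposite.op x)).map p).hom.hom (sumCoeff y x) = sumCoeff y' x := by
  refine (Finsupp.lhom_ext' fun r => LinearMap.ext_ring ?_ :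
    (_ : Module.Dual k ((y' ⟶ x) →₀ k)) = _)
  refine Eq.trans ?_ (sumCoeff_single y' x r).symm
  refine Eq.trans ?_ (sumCoeff_single y x (p ≫ r))
  change (show Module.Dual k ((y ⟶ x) →₀ k) from sumCoeff y x)
    (Finsupp.mapDomain (fun r => p ≫ r) (Finsupp.single r 1)) = _
  rw [Finsupp.mapDomain_single]

lemma injBimod_map_right (y : Paths Γ) {x x' : Paths Γ} (f : x ⟶ x') :
    (((injBimod k Γ).map f.op).app y).hom.hom (sumCoeff y x') = sumCoeff y x := by
  refine (Finsupp.lhom_ext' fun r => LinearMap.ext_ring ?_ :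
    (_ : Module.Dual k ((y ⟶ x) →₀ k)) = _)
  refine Eq.trans ?_ (sumCoeff_single y x r).symm
  refine Eq.trans ?_ (sumCoeff_single y x' (r ≫ f))
  change (show Module.Dual k ((y ⟶ x') →₀ k) from sumCoeff y x')
    (Finsupp.mapDomain (fun r => r ≫ f) (Finsupp.single r 1)) = _
  rw [Finsupp.mapDomain_single]

variable (k) in
/-- The dual of the bimodule `F_i I`. -/
abbrev dualProjInj (i : Γ) : Bimod k Γ := dualBimod (injBimod k Γ ⋙ projFunctor k i)

/-- The trace of the simple module `L_i` in the injective module at `x`, at the vertex `y`. -/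
abbrev injTrace (k : Type u) [Field k] (i : Γ) (x y : Paths Γ) :
    Submodule k (((injBimod k Γ).obj (Opposite.op x)).obj y) :=
  trace (simpleRep k i) ((injBimod k Γ).obj (Opposite.op x)) y

variable (k) in
/-- Evaluation of elements of `(F_i I)^*` at the class of the sum of coefficients. -/
def coeffMap (i : Γ) (y x : Paths Γ) : ((dualProjInj k i).obj (Opposite.op y)).obj x →ₗ[k] k :=
  (Module.Dual.eval k (((injBimod k Γ).obj (Opposite.op x)).obj y ⧸ injTrace k i x y)
    (Submodule.Quotient.mk (sumCoeff y x)))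

lemma coeffMap_map_left (i : Γ) (y : Paths Γ) {x x' : Paths Γ} (f : x ⟶ x')
    (v : ((dualProjInj k i).obj (Opposite.op y)).obj x) :
    coeffMap k i y x' ((((dualProjInj k i).obj (Opposite.op y)).map f).hom.hom v) =
      coeffMap k i y x v :=
  congrArg (fun d => (show Module.Dual k
    (((injBimod k Γ).obj (Opposite.op x)).obj y ⧸ injTrace k i x y) from v)
      (Submodule.Quotient.mk d)) (injBimod_map_right y f)

lemma coeffMap_map_right (i : Γ) {y y' : Paths Γ} (p : y ⟶ y') (x : Paths Γ)
    (v : ((dualProjInj k i).obj (Opposite.op y')).obj x) :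
    coeffMap k i y x ((((dualProjInj k i).map p.op).app x).hom.hom v) =
      coeffMap k i y' x v :=
  congrArg (fun d => (show Module.Dual k
    (((injBimod k Γ).obj (Opposite.op x)).obj y' ⧸ injTrace k i x y') from v)
      (Submodule.Quotient.mk d)) (injBimod_map_left p x)

/-- For `x ≠ i`, the value of a functional on a path `r : y ⟶ x` is read off at the identity of `x`
after acting by `r`; for the image of an element of `L_i` this is zero, since `L_i` vanishes at `x`.
-/
lemma injTrace_eq_bot {i : Γ} {x y : Paths Γ} (h : ¬ (y = i ∧ x = i)) : injTrace k i x y = ⊥ := by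
  rw [eq_bot_iff]
  refine iSup_le fun φ => ?_
  rintro _ ⟨v, rfl⟩
  rw [Submodule.mem_bot]
  by_cases hy : y = i
  · have hx : x ≠ i := fun hx => h ⟨hy, hx⟩
    refine (Finsupp.lhom_ext' fun r => LinearMap.ext_ring ?_ :
      (_ : Module.Dual k ((y ⟶ x) →₀ k)) = 0)
    have h1 : (((injBimod k Γ).obj (Opposite.op x)).map r).hom.hom ((φ.app y).hom.hom v) = 0 := by
      have := congrArg (fun t => t.hom.hom v) (φ.naturality r)
      refine Eq.trans this.symm ?_
      change (φ.app x).hom.hom (((simpleRep k i).map r).hom.hom v) = 0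
      rw [simpleRep_eq_zero hx (((simpleRep k i).map r).hom.hom v), map_zero]
    have h2 := congrArg (fun t : Module.Dual k ((x ⟶ x) →₀ k) => t (Finsupp.single (𝟙 x) 1)) h1
    refine Eq.trans ?_ h2
    change _ = (show Module.Dual k ((y ⟶ x) →₀ k) from (φ.app y).hom.hom v)
      (Finsupp.mapDomain (fun p => r ≫ p) (Finsupp.single (𝟙 x) 1))
    rw [Finsupp.mapDomain_single, Category.comp_id]
    rfl
  · rw [simpleRep_eq_zero hy v, map_zero]

lemma exists_coeffMap_eq_one {i : Γ} {y x : Paths Γ} (r : y ⟶ x) (h : ¬ (y = i ∧ x = i)) :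
    ∃ g, coeffMap k i y x g = 1 := by
  have h0 : (Submodule.Quotient.mk (sumCoeff y x) :
      ((injBimod k Γ).obj (Opposite.op x)).obj y ⧸ injTrace k i x y) ≠ 0 := by
    rw [Ne, Submodule.Quotient.mk_eq_zero, injTrace_eq_bot h, Submodule.mem_bot]
    intro hs
    have := sumCoeff_single (k := k) y x r
    rw [hs] at this
    exact zero_ne_one this
  exact Module.Projective.exists_dual_eq_one k h0

variable [∀ i j : Paths Γ, Subsingleton (i ⟶ j)]

lemma eq_smul_sumCoeff (y x : Paths Γ) (d : ((injBimod k Γ).obj (Opposite.op x)).obj y) :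
    ∃ c : k, d = c • sumCoeff y x := by
  by_cases h : Nonempty (y ⟶ x)
  · obtain ⟨r⟩ := h
    let d' : Module.Dual k ((y ⟶ x) →₀ k) := d
    let s' : Module.Dual k ((y ⟶ x) →₀ k) := sumCoeff y x
    refine ⟨d' (Finsupp.single r 1), ?_⟩
    change d' = d' (Finsupp.single r 1) • s'
    refine Finsupp.lhom_ext' fun r' => LinearMap.ext_ring ?_
    change d' (Finsupp.single r' 1) = d' (Finsupp.single r 1) * s' (Finsupp.single r' 1)
    rw [Subsingleton.elim r' r]
    rw [show s' (Finsupp.single r 1) = 1 from sumCoeff_single y x r, mul_one]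
  · rw [not_nonempty_iff] at h
    refine ⟨0, ?_⟩
    exact Subsingleton.elim (α := Module.Dual k ((y ⟶ x) →₀ k)) _ _

lemma coeffMap_injective (i : Γ) (y x : Paths Γ) : Function.Injective (coeffMap k i y x) := by
  intro b b' h
  refine (LinearMap.ext fun d => ?_ : (show Module.Dual k
    (((injBimod k Γ).obj (Opposite.op x)).obj y ⧸ injTrace k i x y) from b) = b')
  obtain ⟨d, rfl⟩ := Submodule.Quotient.mk_surjective _ d
  obtain ⟨c, rfl⟩ := eq_smul_sumCoeff y x d
  have hb : ∀ a : Module.Dual k (((injBimod k Γ).obj (Opposite.op x)).obj y ⧸ injTrace k i x y),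
      a (Submodule.Quotient.mk (c • sumCoeff y x)) =
        c • a (Submodule.Quotient.mk (sumCoeff y x)) :=
    fun a => (a.comp (injTrace k i x y).mkQ).map_smul c (sumCoeff y x)
  exact (hb b).trans ((congrArg (c • ·) h).trans (hb b').symm)

/-- Any `d` at `i` extends by zero to a homomorphism from `L_i`: a path leaving `i` ends at a vertex
with no path back, where the injective module at `i` vanishes. -/
lemma injTrace_self_eq_top (hanti : ∀ {a b : Paths Γ}, (a ⟶ b) → (b ⟶ a) → a = b) (i : Γ) :
    injTrace k i i i = ⊤ := by
  rw [eq_top_iff]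
  rintro d -
  classical
  let φ : simpleRep k i ⟶ (injBimod k Γ).obj (Opposite.op (show Paths Γ from i)) :=
    { app := fun j => FGModuleCat.ofHom
        (if h : j = i then
          (LinearMap.proj (R := k) (φ := fun _ : PLift (j = i) => k) ⟨h⟩).smulRight (h ▸ d)
        else 0)
      naturality := by
        intro j j' f
        by_cases hj : j = i
        · subst hj
          by_cases hj' : j' = j
          · subst hj'
            exact map_comp_eq_comp_map (simpleRep k (Γ := Γ) j')
              ((injBimod k Γ).obj (Opposite.op (show Paths Γ from j'))) f _
          · have he : IsEmpty (j' ⟶ j) := ⟨fun r => hj' (hanti r f)⟩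
            refine FGModuleCat.hom_ext (LinearMap.ext fun v => ?_)
            exact Subsingleton.elim (α := Module.Dual k ((j' ⟶ j) →₀ k)) _ _
        · refine FGModuleCat.hom_ext (LinearMap.ext fun v => ?_)
          rw [simpleRep_eq_zero hj v, map_zero, map_zero] }
  refine Submodule.mem_iSup_of_mem φ ⟨(fun _ => 1 : PLift (i = i) → k), ?_⟩
  change (if h : i = i then
          (LinearMap.proj (R := k) (φ := fun _ : PLift (i = i) => k) ⟨h⟩).smulRight (h ▸ d)
        else 0 : (PLift (i = i) → k) →ₗ[k] _) (fun _ => 1) = d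
  simp

lemma subsingleton_dualProjInj_of_isEmpty {i : Γ} {y x : Paths Γ} (h : IsEmpty (y ⟶ x)) :
    Subsingleton (((dualProjInj k i).obj (Opposite.op y)).obj x) := by
  refine ⟨fun b b' => coeffMap_injective i y x ?_⟩
  have h0 : sumCoeff (k := k) y x = 0 :=
    Subsingleton.elim (α := Module.Dual k ((y ⟶ x) →₀ k)) _ _
  have h1 : coeffMap k i y x = 0 := by
    rw [coeffMap, h0]
    exact map_zero (Module.Dual.eval k
      (((injBimod k Γ).obj (Opposite.op x)).obj y ⧸ injTrace k i x y))
  rw [h1]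
  rfl

lemma subsingleton_dualProjInj_self
    (hanti : ∀ {a b : Paths Γ}, (a ⟶ b) → (b ⟶ a) → a = b) (i : Γ) :
    Subsingleton (((dualProjInj k i).obj (Opposite.op (show Paths Γ from i))).obj i) := by
  refine ⟨fun b b' => coeffMap_injective i i i ?_⟩
  have h0 : (Submodule.Quotient.mk (sumCoeff (k := k) (Γ := Γ) i i) :
      ((injBimod k Γ).obj (Opposite.op (show Paths Γ from i))).obj i ⧸ injTrace k i i i) = 0 := by
    rw [Submodule.Quotient.mk_eq_zero, injTrace_self_eq_top hanti]
    trivial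
  have h1 : coeffMap k i i i = 0 :=
    (congrArg (Module.Dual.eval k _) h0).trans (map_zero (Module.Dual.eval k
      (((injBimod k Γ).obj (Opposite.op (show Paths Γ from i))).obj i ⧸ injTrace k i i i)))
  rw [h1]
  rfl

end Bimodules

end QuiverCat

end

noncomputable section

namespace QuiverCat

/-! ### The linear quiver. -/

section Linear

variable {k : Type u} [Field k] {m : ℕ}

lemma LinearQuiver.nonempty_path {i j : Paths (LinearQuiver m)}
    (h : Fin.val (n := m) i ≤ Fin.val (n := m) j) : Nonempty (i ⟶ j) := by
  obtain ⟨b, hb⟩ := (j : Fin m)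
  induction b with
  | zero =>
    obtain rfl : i = (⟨0, hb⟩ : Fin m) := Fin.ext (Nat.le_zero.1 h)
    exact ⟨𝟙 _⟩
  | succ b ih =>
    rcases Nat.lt_or_ge b (Fin.val (n := m) i) with h' | h'
    · obtain rfl : i = (⟨b + 1, hb⟩ : Fin m) := Fin.ext (le_antisymm h h')
      exact ⟨𝟙 _⟩
    · obtain ⟨p⟩ := ih (by omega) h'
      exact ⟨Quiver.Path.cons p (PLift.up rfl)⟩

lemma LinearQuiver.eq_of_paths {i j : Paths (LinearQuiver m)} (p : i ⟶ j) (q : j ⟶ i) : i = j :=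
  Fin.ext (le_antisymm (LinearQuiver.path_val_le p) (LinearQuiver.path_val_le q))

lemma isLocallyEval_G (i : LinearQuiver m) : IsLocallyEval (G k i) := by
  refine isLocallyEval_homFunctor (dualProjInj k i) (coeffMap k i) (coeffMap_injective i)
    (coeffMap_map_left i) (coeffMap_map_right i) fun y => ?_
  have hempty : ∀ x : Paths (LinearQuiver m), ¬ Fin.val (n := m) y ≤ Fin.val (n := m) x →
      Subsingleton (((dualProjInj k i).obj (Opposite.op y)).obj x) := fun x h =>
    subsingleton_dualProjInj_of_isEmpty ⟨fun r => h (LinearQuiver.path_val_le r)⟩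
  by_cases hy : y = i
  · subst hy
    have hx : ∀ x : Paths (LinearQuiver m), ¬ Fin.val (n := m) y + 1 ≤ Fin.val (n := m) x →
        Subsingleton (((dualProjInj k (Γ := LinearQuiver m) y).obj (Opposite.op y)).obj x) := by
      intro x h
      by_cases hxy : x = y
      · subst hxy
        exact subsingleton_dualProjInj_self (Γ := LinearQuiver m) LinearQuiver.eq_of_paths x
      · refine hempty x fun h' => hxy (Fin.ext ?_)
        omega
    rcases Nat.lt_or_ge (Fin.val (n := m) y + 1) m with hm | hm
    · right
      -- With the value at `y` itself removed, the surviving module is generated at the next vertex.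
      let s : Paths (LinearQuiver m) := (⟨Fin.val (n := m) y + 1, hm⟩ : Fin m)
      have hs : Fin.val (n := m) s = Fin.val (n := m) y + 1 := rfl
      obtain ⟨r⟩ : Nonempty (y ⟶ s) := LinearQuiver.nonempty_path (by omega)
      obtain ⟨g, hg⟩ := exists_coeffMap_eq_one (k := k) (Γ := LinearQuiver m) (i := y) r (by
        rintro ⟨-, h⟩
        have := congrArg (Fin.val (n := m)) h
        omega)
      refine ⟨s, g, hg, fun x => ?_⟩
      by_cases h : Fin.val (n := m) y + 1 ≤ Fin.val (n := m) x
      · exact Or.inl (LinearQuiver.nonempty_path h)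
      · exact Or.inr (hx x h)
    -- At the last vertex nothing survives.
    · left
      intro x
      have := Fin.isLt (n := m) x
      exact hx x (by omega)
  · right
    obtain ⟨g, hg⟩ := exists_coeffMap_eq_one (k := k) (i := i) (𝟙 y) (fun h => hy h.1)
    refine ⟨y, g, hg, fun x => ?_⟩
    by_cases h : Fin.val (n := m) y ≤ Fin.val (n := m) x
    · exact Or.inl (LinearQuiver.nonempty_path h)
    · exact Or.inr (hempty x h)

lemma isLocallyEval_compG (l : List (LinearQuiver m)) : IsLocallyEval (compG k l) := by
  induction l with
  | nil => exact isLocallyEval_id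
  | cons i l ih => exact ih.comp (isLocallyEval_G i)

end Linear

end QuiverCat

end

theorem proposition3 {k : Type u} [Field k] [IsAlgClosed k] (m : ℕ)
    (i : List (QuiverCat.LinearQuiver m)) :
    IsZero (QuiverCat.compG k i) ∨ Indecomposable (QuiverCat.compG k i) := by
  refine or_iff_not_imp_left.2 fun h => ⟨h, fun Y Z e => ?_⟩
  refine QuiverCat.isZero_or_isZero_of_end_scalar (k := k) (fun t => ?_) e
  -- Without vertices every functor is zero; otherwise vertex `0` has a path to every vertex.
  rcases Nat.eq_zero_or_pos m with rfl | hm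
  · refine absurd ?_ h
    rw [Functor.isZero_iff]
    intro M
    rw [Functor.isZero_iff]
    exact fun y => Fin.elim0 y
  · exact (QuiverCat.isLocallyEval_compG i).exists_scalar
      (show Paths (QuiverCat.LinearQuiver m) from (⟨0, hm⟩ : Fin m))
      (fun y => QuiverCat.LinearQuiver.nonempty_path (Nat.zero_le _)) t
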